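/- For a set $A \subseteq \mathbb{F}_2^n$ write $A+A=\{a_1+a_2 : a_1,a_2\in A\}$ and, for $s\in\mathbb{F}_2^n$, $A(s)=A\cap(s+A)$. Let $A \subseteq \mathbb{F}_2^n$ be non-empty with $|A+A| = K|A|$. Suppose that there are an element $a^*\in\mathbb{F}_2^n$, an integer $L\ge 0$ and a real number $\varepsilon > 10/\log_2 K$ (for $K=1$ this condition is read as $\varepsilon>0$) such that the set $$B = \{b \in A : |A(a^*+b)| > |A|(1-K^{-\varepsilon})\}$$ satisfies $|B| \ge K^{-L}|A|$. Then the linear span of $B$ over $\mathbb{F}_2$ satisfies $$|\operatorname{span}(B)| \le 2^{(4^{L/\varepsilon})}\cdot|A+A|.$$ -/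

import Mathlib

open scoped Pointwise

/-- `A(s) = A ∩ (s + A)` for a finite set `A ⊆ 𝔽₂ⁿ`. -/
def shiftInter {n : ℕ} (A : Finset (Fin n → ZMod 2)) (s : Fin n → ZMod 2) :
    Finset (Fin n → ZMod 2) :=
  A ∩ ({s} + A)

/-- `B = {b ∈ A : |A(a* + b)| > |A| (1 - K^(-ε))}`. -/
noncomputable def popularPart {n : ℕ} (A : Finset (Fin n → ZMod 2)) (K ε : ℝ)
    (a : Fin n → ZMod 2) : Finset (Fin n → ZMod 2) :=
  A.filter fun b => ((shiftInter A (a + b)).card : ℝ) > (A.card : ℝ) * (1 - K ^ (-ε))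

/-! Let δ = K^(-ε) and C = a + B. The defect |A \ (s + A)| is subadditive in s and less than δ|A| on
C. A shift with defect below |A| lies in A + A, and at most 2|A| shifts have defect at most |A|/2.
Take T ⊆ C + C + C maximal dissociated modulo C, and d = |T|; then span C is covered by the subset
sums of T plus C + C (`exists_dissociatedMod_cover`). If (3d + 2)δ ≤ 1, all of span C lies in A + A.
Otherwise d is large, and the disjoint translates of C by k-fold sums of T consist of shifts of
small defect, so binom(d, k)|C| ≤ 2|A| and binom(d, k) ≤ 2K^L. For k just above ε log₂ K this forces
d + 1 ≤ 4^(L/ε), while |span C| ≤ 2^d |A + A|. Undoing the translation by a costs the last factor 2.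
-/

section

variable {G : Type*} [AddCommGroup G]

section

variable [Module (ZMod 2) G]

theorem add_self_of_zmod_two (x : G) : x + x = 0 := by
  rw [← two_smul (ZMod 2) x, show (2 : ZMod 2) = 0 from rfl, zero_smul]

theorem add_add_self_left (x y : G) : x + (x + y) = y := by
  rw [← add_assoc, add_self_of_zmod_two, zero_add]

theorem mem_span_finset_zmod_two {T : Finset G} {x : G}
    (hx : x ∈ Submodule.span (ZMod 2) (T : Set G)) : ∃ S ⊆ T, ∑ t ∈ S, t = x := by
  obtain ⟨f, -, rfl⟩ := Submodule.mem_span_finset.1 hx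
  refine ⟨T.filter fun t => f t = 1, Finset.filter_subset _ _, ?_⟩
  rw [Finset.sum_filter]
  refine Finset.sum_congr rfl fun t _ => ?_
  have h : f t = 0 ∨ f t = 1 := by generalize f t = y; revert y; decide
  rcases h with h | h <;> simp [h]

theorem sum_mem_span {T S : Finset G} (hS : S ⊆ T) :
    ∑ t ∈ S, t ∈ Submodule.span (ZMod 2) (T : Set G) :=
  Submodule.sum_mem _ fun _ ht => Submodule.subset_span (hS ht)

/-- Translating a set at most doubles the size of its span. -/
theorem card_span_le_two_mul_card [Finite G] {B : Set G} {W : Submodule (ZMod 2) G} {a : G}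
    (h : ∀ b ∈ B, a + b ∈ W) : Nat.card (Submodule.span (ZMod 2) B) ≤ 2 * Nat.card W := by
  have hsub : (Submodule.span (ZMod 2) B : Set G) ⊆ (W : Set G) ∪ (fun x => a + x) '' W := by
    have key : ∀ x ∈ Submodule.span (ZMod 2) B, x ∈ W ∨ a + x ∈ W := by
      intro x hx
      induction hx using Submodule.span_induction with
      | mem x hx => exact Or.inr (h x hx)
      | zero => exact Or.inl W.zero_mem
      | add x y _ _ hx hy =>
        rcases hx with hx | hx <;> rcases hy with hy | hy
        · exact Or.inl (W.add_mem hx hy)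
        · exact Or.inr (by rw [add_left_comm]; exact W.add_mem hx hy)
        · exact Or.inr (by rw [← add_assoc]; exact W.add_mem hx hy)
        · left
          have := W.add_mem hx hy
          rwa [add_add_add_comm, add_self_of_zmod_two, zero_add] at this
      | smul r x _ hx =>
        have hr : r = 0 ∨ r = 1 := by revert r; decide
        rcases hr with rfl | rfl
        · exact Or.inl (by rw [zero_smul]; exact W.zero_mem)
        · rwa [one_smul]
    intro x hx
    rcases key x hx with h | h
    · exact Or.inl h
    · exact Or.inr ⟨a + x, h, add_add_self_left a x⟩
  have h1 := Set.ncard_le_ncard hsub (Set.toFinite _)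
  have h2 := Set.ncard_union_le (W : Set G) ((fun x => a + x) '' W)
  have h3 := Set.ncard_image_le (f := fun x => a + x) (Set.toFinite (W : Set G))
  change (Submodule.span (ZMod 2) B : Set G).ncard ≤ 2 * (W : Set G).ncard
  omega

end

/-! ### Shift defects, dissociated sets and the covering dichotomy -/

variable [DecidableEq G]

/-- The number of `x ∈ A` which translation by `s` moves out of `A`. -/
def shiftDefect (A : Finset G) (s : G) : ℕ := (A.filter fun x => s + x ∉ A).card

theorem shiftDefect_zero (A : Finset G) : shiftDefect A 0 = 0 := by
  simp [shiftDefect]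

/-- A set of shifts which keep at least half of `A` inside `A` has at most `2 |A|` elements. -/
theorem card_le_of_shiftDefect_le {A Y : Finset G} (hA : A.Nonempty)
    (h : ∀ s ∈ Y, 2 * shiftDefect A s ≤ A.card) : Y.card ≤ 2 * A.card := by
  have h1 : Y.card * A.card ≤ ∑ s ∈ Y, 2 * (A.filter fun x => s + x ∈ A).card := by
    rw [← smul_eq_mul]
    refine Finset.card_nsmul_le_sum _ _ _ fun s hs => ?_
    have h2 := h s hs
    have h3 := Finset.card_filter_add_card_filter_not (s := A) (fun x => s + x ∈ A)
    unfold shiftDefect at h2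
    omega
  -- Double count pairs (s, x) with s + x ∈ A: each x admits at most |A| values of s.
  have h2 : ∑ s ∈ Y, (A.filter fun x => s + x ∈ A).card ≤ A.card * A.card := by
    simp_rw [Finset.card_filter]
    rw [Finset.sum_comm, ← smul_eq_mul (A.card)]
    refine Finset.sum_le_card_nsmul _ _ _ fun x _ => ?_
    rw [← Finset.card_filter]
    refine Finset.card_le_card_of_injOn (fun s => s + x) ?_ ?_
    · intro s hs
      exact (Finset.mem_filter.1 hs).2
    · intro s _ t _ hst
      exact add_right_cancel hst
  rw [← Finset.mul_sum] at h1
  have h3 : Y.card * A.card ≤ (2 * A.card) * A.card := by nlinarith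
  exact Nat.le_of_mul_le_mul_right h3 hA.card_pos

/-- The translates of `C` by the subset sums of `T` are pairwise disjoint. -/
def DissociatedMod (C T : Finset G) : Prop :=
  ∀ S ⊆ T, ∀ S' ⊆ T, ∀ c ∈ C, ∀ c' ∈ C, ∑ t ∈ S, t + c = ∑ t ∈ S', t + c' → S = S'

/-- The translates of `C` by the `k`-fold subset sums of a dissociated set are disjoint. -/
theorem DissociatedMod.exists_finset {C T : Finset G} (hT : DissociatedMod C T) (k : ℕ) :
    ∃ Y : Finset G, Y.card = T.card.choose k * C.card ∧
      ∀ y ∈ Y, ∃ S ⊆ T, S.card = k ∧ ∃ c ∈ C, y = ∑ t ∈ S, t + c := by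
  refine ⟨(T.powersetCard k ×ˢ C).image fun p => ∑ t ∈ p.1, t + p.2, ?_, ?_⟩
  · rw [Finset.card_image_of_injOn, Finset.card_product, Finset.card_powersetCard]
    rintro ⟨S, c⟩ h ⟨S', c'⟩ h' e
    simp only [Finset.coe_product, Set.mem_prod, Finset.mem_coe, Finset.mem_powersetCard] at h h' e
    obtain rfl := hT S h.1.1 S' h'.1.1 c h.2 c' h'.2 e
    rw [add_left_cancel e]
  · intro y hy
    obtain ⟨⟨S, c⟩, hp, rfl⟩ := Finset.mem_image.1 hy
    simp only [Finset.mem_product, Finset.mem_powersetCard] at hp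
    exact ⟨S, hp.1.1, hp.1.2, c, hp.2, rfl⟩

variable [Module (ZMod 2) G]

theorem shiftDefect_add_le (A : Finset G) (s t : G) :
    shiftDefect A (s + t) ≤ shiftDefect A s + shiftDefect A t := by
  unfold shiftDefect
  have h : (A.filter fun x => s + t + x ∉ A) ⊆
      (A.filter fun x => t + x ∉ A) ∪ ((A.filter fun x => s + x ∉ A).image fun x => t + x) := by
    intro x hx
    simp only [Finset.mem_filter, Finset.mem_union, Finset.mem_image] at hx ⊢
    by_cases h : t + x ∈ A
    · exact Or.inr ⟨t + x, ⟨h, by rw [← add_assoc]; exact hx.2⟩, add_add_self_left t x⟩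
    · exact Or.inl ⟨hx.1, h⟩
  have h1 := Finset.card_le_card h
  have h2 := Finset.card_union_le (A.filter fun x => t + x ∉ A)
    ((A.filter fun x => s + x ∉ A).image fun x => t + x)
  have h3 := Finset.card_image_le (s := A.filter fun x => s + x ∉ A) (f := fun x => t + x)
  omega

theorem shiftDefect_sum_le (A : Finset G) (S : Finset G) :
    shiftDefect A (∑ t ∈ S, t) ≤ ∑ t ∈ S, shiftDefect A t := by
  induction S using Finset.induction_on with
  | empty => simp [shiftDefect_zero]
  | insert a s ha ih =>
    rw [Finset.sum_insert ha, Finset.sum_insert ha]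
    exact (shiftDefect_add_le A _ _).trans (by omega)

theorem mem_add_of_shiftDefect_lt {A : Finset G} {s : G} (h : shiftDefect A s < A.card) :
    s ∈ A + A := by
  obtain ⟨x, hx, hxs⟩ : ∃ x ∈ A, s + x ∈ A := by
    by_contra! hc
    rw [shiftDefect, Finset.filter_true_of_mem hc] at h
    exact lt_irrefl _ h
  refine Finset.mem_add.2 ⟨s + x, hxs, x, hx, ?_⟩
  rw [add_assoc, add_self_of_zmod_two, add_zero]

/-- A new coincidence must involve x on exactly one side, since otherwise x cancels or is absent,
contradicting `hT`. Solve for x. -/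
theorem exists_mem_span_add_add_of_not_dissociatedMod {C T : Finset G} {x : G}
    (hT : DissociatedMod C T) (hx : ¬ DissociatedMod C (insert x T)) :
    ∃ v ∈ Submodule.span (ZMod 2) (T : Set G), ∃ c ∈ C, ∃ c' ∈ C, x = v + (c + c') := by
  unfold DissociatedMod at hx
  push Not at hx
  obtain ⟨S, hS, S', hS', c, hc, c', hc', h, hne⟩ := hx
  have aux : ∀ S S' : Finset G, S ⊆ insert x T → S' ⊆ insert x T → ∀ c c' : G,
      ∑ t ∈ S, t + c = ∑ t ∈ S', t + c' → x ∈ S → x ∉ S' →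
      ∃ v ∈ Submodule.span (ZMod 2) (T : Set G), x = v + (c + c') := by
    intro S S' hS hS' c c' h hxS hxS'
    refine ⟨∑ t ∈ S.erase x, t + ∑ t ∈ S', t, Submodule.add_mem _
      (sum_mem_span (Finset.subset_insert_iff.1 hS))
      (sum_mem_span ((Finset.subset_insert_iff_of_notMem hxS').1 hS')), ?_⟩
    rw [← Finset.add_sum_erase S (fun t => t) hxS] at h
    have h1 : x = ∑ t ∈ S', t + c' - c - ∑ t ∈ S.erase x, t := by rw [← h]; abel
    have neg : ∀ y : G, -y = y := fun y => neg_eq_of_add_eq_zero_left (add_self_of_zmod_two y)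
    rw [sub_eq_add_neg, sub_eq_add_neg, neg, neg] at h1
    refine h1.trans ?_
    abel
  by_cases h1 : x ∈ S <;> by_cases h2 : x ∈ S'
  · refine absurd ?_ hne
    have := hT (S.erase x) (Finset.subset_insert_iff.1 hS) (S'.erase x)
      (Finset.subset_insert_iff.1 hS') c hc c' hc' ?_
    · rw [← Finset.insert_erase h1, ← Finset.insert_erase h2, this]
    · rw [← Finset.add_sum_erase S (fun t => t) h1, ← Finset.add_sum_erase S' (fun t => t) h2,
        add_assoc, add_assoc] at h
      exact add_left_cancel h
  · obtain ⟨v, hv, e⟩ := aux S S' hS hS' c c' h h1 h2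
    exact ⟨v, hv, c, hc, c', hc', e⟩
  · obtain ⟨v, hv, e⟩ := aux S' S hS' hS c' c h.symm h2 h1
    exact ⟨v, hv, c', hc', c, hc, e⟩
  · exact absurd (hT S ((Finset.subset_insert_iff_of_notMem h1).1 hS) S'
      ((Finset.subset_insert_iff_of_notMem h2).1 hS') c hc c' hc' h) hne

/-- Covering lemma: a maximal `T ⊆ C + C + C` that is dissociated modulo `C` satisfies
`span C ⊆ span T + C + C`. -/
theorem exists_dissociatedMod_cover {C : Finset G} (hC : C.Nonempty) :
    ∃ T ⊆ C + C + C, DissociatedMod C T ∧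
      ∀ x ∈ Submodule.span (ZMod 2) (C : Set G), ∃ S ⊆ T, ∃ y ∈ C + C, x = ∑ t ∈ S, t + y := by
  classical
  obtain ⟨c₀, hc₀⟩ := hC
  have hne : ((C + C + C).powerset.filter fun T => DissociatedMod C T).Nonempty := by
    refine ⟨∅, Finset.mem_filter.2 ⟨Finset.empty_mem_powerset _, ?_⟩⟩
    intro S hS S' hS' _ _ _ _ _
    rw [Finset.subset_empty.1 hS, Finset.subset_empty.1 hS']
  obtain ⟨T, hT, hmax⟩ := Finset.exists_max_image _ Finset.card hne
  obtain ⟨hTC, hT⟩ := Finset.mem_filter.1 hT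
  rw [Finset.mem_powerset] at hTC
  refine ⟨T, hTC, hT, ?_⟩
  have key : ∀ x ∈ C + C + C, ∃ v ∈ Submodule.span (ZMod 2) (T : Set G),
      ∃ y ∈ C + C, x = v + y := by
    intro x hx
    by_cases hxT : x ∈ T
    · exact ⟨x, Submodule.subset_span hxT, c₀ + c₀, Finset.add_mem_add hc₀ hc₀,
        by rw [add_self_of_zmod_two, add_zero]⟩
    · obtain ⟨v, hv, c, hc, c', hc', e⟩ := exists_mem_span_add_add_of_not_dissociatedMod hT
        (fun hd => by
          have := hmax (insert x T) (Finset.mem_filter.2 ⟨Finset.mem_powerset.2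
            (Finset.insert_subset hx hTC), hd⟩)
          rw [Finset.card_insert_of_notMem hxT] at this
          omega)
      exact ⟨v, hv, c + c', Finset.add_mem_add hc hc', e⟩
  -- Adding c gives a remainder in C + C + C, which `key` reduces to C + C; this is why T is sought
  -- among threefold sums.
  have step : ∀ x, (∃ v ∈ Submodule.span (ZMod 2) (T : Set G), ∃ y ∈ C + C, x = v + y) →
      ∀ c ∈ C, ∃ v ∈ Submodule.span (ZMod 2) (T : Set G), ∃ y ∈ C + C, x + c = v + y := by
    rintro x ⟨v, hv, y, hy, rfl⟩ c hc
    obtain ⟨w, hw, z, hz, e⟩ := key (y + c) (Finset.add_mem_add hy hc)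
    exact ⟨v + w, Submodule.add_mem _ hv hw, z, hz, by rw [add_assoc, e, add_assoc]⟩
  intro x hx
  obtain ⟨S, hS, rfl⟩ := mem_span_finset_zmod_two hx
  have : ∃ v ∈ Submodule.span (ZMod 2) (T : Set G), ∃ y ∈ C + C, ∑ t ∈ S, t = v + y := by
    clear hx
    induction S using Finset.induction_on with
    | empty => exact ⟨0, Submodule.zero_mem _, c₀ + c₀, Finset.add_mem_add hc₀ hc₀,
        by simp [add_self_of_zmod_two]⟩
    | insert c s hc ih =>
      rw [Finset.sum_insert hc, add_comm c]
      exact step _ (ih fun y hy => hS (Finset.mem_insert_of_mem hy)) c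
        (hS (Finset.mem_insert_self _ _))
  obtain ⟨v, hv, y, hy, e⟩ := this
  obtain ⟨S', hS', rfl⟩ := mem_span_finset_zmod_two hv
  exact ⟨S', hS', y, hy, e⟩

theorem shiftDefect_add_lt {A : Finset G} {s t : G} {p q : ℝ}
    (hs : (shiftDefect A s : ℝ) < p) (ht : (shiftDefect A t : ℝ) < q) :
    (shiftDefect A (s + t) : ℝ) < p + q := by
  have h : (shiftDefect A (s + t) : ℝ) ≤ shiftDefect A s + shiftDefect A t := by
    exact_mod_cast shiftDefect_add_le A s t
  linarith

theorem shiftDefect_sum_le_mul {A S : Finset G} {q : ℝ}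
    (h : ∀ t ∈ S, (shiftDefect A t : ℝ) < q) :
    (shiftDefect A (∑ t ∈ S, t) : ℝ) ≤ S.card * q := by
  have h1 : (shiftDefect A (∑ t ∈ S, t) : ℝ) ≤ ∑ t ∈ S, (shiftDefect A t : ℝ) := by
    exact_mod_cast shiftDefect_sum_le A S
  refine h1.trans ?_
  rw [← nsmul_eq_mul]
  exact Finset.sum_le_card_nsmul _ _ _ fun t ht => (h t ht).le

/-- Dichotomy for a set `C` of shifts with defect less than `δ |A|`: either its span lies in
`A + A`, or it is covered by few translates of `C + C`. -/
theorem span_subset_or_card_span_le {A C : Finset G} (hA : A.Nonempty) (hC : C.Nonempty)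
    {δ : ℝ} (hδ : 0 < δ) (hδ2 : 2 * δ ≤ 1)
    (hdef : ∀ c ∈ C, (shiftDefect A c : ℝ) < δ * A.card) :
    (∀ x ∈ Submodule.span (ZMod 2) (C : Set G), x ∈ A + A) ∨
    ∃ d : ℕ, 1 < (3 * d + 2) * δ ∧
      Nat.card (Submodule.span (ZMod 2) (C : Set G)) ≤ 2 ^ d * (A + A).card ∧
      ∀ k : ℕ, 2 * ((3 * k + 1) * δ) ≤ 1 → d.choose k * C.card ≤ 2 * A.card := by
  have hA' : (0 : ℝ) < A.card := by exact_mod_cast hA.card_pos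
  have hdef2 : ∀ y ∈ C + C, (shiftDefect A y : ℝ) < 2 * δ * A.card := by
    intro y hy
    obtain ⟨c, hc, c', hc', rfl⟩ := Finset.mem_add.1 hy
    linarith [shiftDefect_add_lt (hdef c hc) (hdef c' hc')]
  obtain ⟨T, hTC, hT, hcov⟩ := exists_dissociatedMod_cover hC
  have hdef3 : ∀ t ∈ T, (shiftDefect A t : ℝ) < 3 * δ * A.card := by
    intro t ht
    obtain ⟨y, hy, c, hc, rfl⟩ := Finset.mem_add.1 (hTC ht)
    linarith [shiftDefect_add_lt (hdef2 y hy) (hdef c hc)]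
  have hsum : ∀ S ⊆ T, (shiftDefect A (∑ t ∈ S, t) : ℝ) ≤ S.card * (3 * δ * A.card) :=
    fun S hS => shiftDefect_sum_le_mul fun t ht => hdef3 t (hS ht)
  have hadd : ∀ (s y : G) (q : ℝ), (shiftDefect A y : ℝ) < q →
      (shiftDefect A (s + y) : ℝ) < shiftDefect A s + q := by
    intro s y q hy
    have h : (shiftDefect A (s + y) : ℝ) ≤ shiftDefect A s + shiftDefect A y := by
      exact_mod_cast shiftDefect_add_le A s y
    linarith
  -- Each element of T costs 3δ and the remainder in C + C costs 2δ.
  by_cases hd : (3 * (T.card : ℝ) + 2) * δ ≤ 1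
  · left
    intro x hx
    obtain ⟨S, hS, y, hy, rfl⟩ := hcov x hx
    refine mem_add_of_shiftDefect_lt ?_
    have h1 := hadd (∑ t ∈ S, t) y _ (hdef2 y hy)
    have h2 := hsum S hS
    have h3 : (S.card : ℝ) ≤ T.card := by exact_mod_cast Finset.card_le_card hS
    have h4 : (S.card : ℝ) * (3 * δ * A.card) ≤ T.card * (3 * δ * A.card) := by gcongr
    have h5 := mul_le_mul_of_nonneg_right hd hA'.le
    have : (shiftDefect A (∑ t ∈ S, t + y) : ℝ) < A.card := by linarith
    exact_mod_cast this
  · right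
    refine ⟨T.card, not_le.1 hd, ?_, ?_⟩
    · have hsub : (Submodule.span (ZMod 2) (C : Set G) : Set G) ⊆
          ((T.powerset ×ˢ (A + A)).image fun p => ∑ t ∈ p.1, t + p.2 : Finset G) := by
        intro x hx
        obtain ⟨S, hS, y, hy, rfl⟩ := hcov x hx
        refine Finset.mem_coe.2 (Finset.mem_image.2 ⟨(S, y), Finset.mem_product.2
          ⟨Finset.mem_powerset.2 hS, mem_add_of_shiftDefect_lt ?_⟩, rfl⟩)
        have h1 := hdef2 y hy
        have h2 := mul_le_mul_of_nonneg_right hδ2 hA'.le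
        have : (shiftDefect A y : ℝ) < A.card := by linarith
        exact_mod_cast this
      have h1 := Set.ncard_le_ncard hsub (Finset.finite_toSet _)
      rw [Set.ncard_coe_finset] at h1
      refine h1.trans (Finset.card_image_le.trans ?_)
      rw [Finset.card_product, Finset.card_powerset]
    · intro k hk
      obtain ⟨Y, hY, hYS⟩ := hT.exists_finset k
      rw [← hY]
      refine card_le_of_shiftDefect_le hA fun y hy => ?_
      obtain ⟨S, hS, hSk, c, hc, rfl⟩ := hYS y hy
      have h1 := hadd (∑ t ∈ S, t) c _ (hdef c hc)
      have h2 := hsum S hS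
      rw [hSk] at h2
      have h3 := mul_le_mul_of_nonneg_right hk hA'.le
      have : (2 * shiftDefect A (∑ t ∈ S, t + c) : ℝ) ≤ A.card := by linarith
      exact_mod_cast this

/-- If `|A + A| = |A|`, then `A + A` is closed under addition. -/
theorem span_subset_of_card_add_eq {A C : Finset G} (hA : A.Nonempty)
    (h : (A + A).card = A.card) (hC : C ⊆ A + A) :
    ∀ x ∈ Submodule.span (ZMod 2) (C : Set G), x ∈ A + A := by
  intro x hx
  obtain ⟨S, hS, rfl⟩ := mem_span_finset_zmod_two hx
  clear hx
  induction S using Finset.induction_on with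
  | empty =>
    obtain ⟨a, ha⟩ := hA
    rw [Finset.sum_empty, ← add_self_of_zmod_two a]
    exact Finset.add_mem_add ha ha
  | insert c s hc ih =>
    rw [Finset.sum_insert hc]
    obtain ⟨u, hu, v, hv, e⟩ := Finset.mem_add.1 (hC (hS (Finset.mem_insert_self _ _)))
    -- The sumset is a single translate v + A, so adding u + v to v + w leaves u + w.
    have hv' : A.image (fun x => v + x) = A + A := by
      refine Finset.eq_of_subset_of_card_le ?_ ?_
      · intro y hy
        obtain ⟨z, hz, rfl⟩ := Finset.mem_image.1 hy
        exact Finset.add_mem_add hv hz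
      · rw [h, Finset.card_image_of_injective _ (add_right_injective v)]
    have := ih fun y hy => hS (Finset.mem_insert_of_mem hy)
    rw [← hv'] at this
    obtain ⟨w, hw, e'⟩ := Finset.mem_image.1 this
    rw [← e, ← e', add_assoc, add_add_self_left]
    exact Finset.add_mem_add hu hw

end

/-! ### Binomial estimates -/

theorem pow_le_pow_mul_choose {d k : ℕ} (h : k ≤ d) : d ^ k ≤ k ^ k * d.choose k := by
  have key : ∀ j ≤ k, d ^ j * k.descFactorial j ≤ k ^ j * d.descFactorial j := by
    intro j
    induction j with
    | zero => simp
    | succ j ih =>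
      intro hj
      have h1 : d * (k - j) ≤ k * (d - j) := by
        rw [Nat.mul_sub, Nat.mul_sub, mul_comm k d]
        exact Nat.sub_le_sub_left (Nat.mul_le_mul_right j h) _
      rw [Nat.descFactorial_succ, Nat.descFactorial_succ]
      calc d ^ (j + 1) * ((k - j) * k.descFactorial j)
          = d * (k - j) * (d ^ j * k.descFactorial j) := by ring
        _ ≤ k * (d - j) * (k ^ j * d.descFactorial j) := Nat.mul_le_mul h1 (ih (by omega))
        _ = k ^ (j + 1) * ((d - j) * d.descFactorial j) := by ring
  have h1 := key k le_rfl
  rw [Nat.descFactorial_self, Nat.descFactorial_eq_factorial_mul_choose, mul_left_comm,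
    mul_comm (d ^ k)] at h1
  exact Nat.le_of_mul_le_mul_left h1 k.factorial_pos

/-- Source of the constant 10 in the hypothesis on ε: the inequality fails at k = 10. Combined with
2^k ≤ 2·2^N < 6d + 4 it gives d ≥ 2k² + 1. -/
theorem twelve_mul_sq_add_ten_le_two_pow {k : ℕ} (hk : 11 ≤ k) : 12 * k ^ 2 + 10 ≤ 2 ^ k := by
  induction k, hk using Nat.le_induction with
  | base => norm_num
  | succ k hk ih => rw [pow_succ 2]; nlinarith

theorem exists_four_mul_rpow_le_choose_sq {N : ℝ} (hN : 10 < N) {d : ℕ}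
    (hd : (2 : ℝ) ^ N < 3 * d + 2) :
    ∃ k : ℕ, 2 * (3 * (k : ℝ) + 1) ≤ 2 ^ N ∧ 4 * ((d : ℝ) + 1) ^ N ≤ (d.choose k : ℝ) ^ 2 := by
  set k := ⌊N⌋₊ + 1 with hk
  have hkN : N < k := by rw [hk]; push_cast; exact Nat.lt_floor_add_one N
  have hNk : ((⌊N⌋₊ : ℕ) : ℝ) ≤ N := Nat.floor_le (by linarith)
  have hk11 : 11 ≤ k := by
    have : 10 ≤ ⌊N⌋₊ := Nat.le_floor (by exact_mod_cast hN.le)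
    omega
  have hpow : (2 : ℝ) ^ k ≤ 2 * 2 ^ N := by
    rw [hk, pow_succ, mul_comm, ← Real.rpow_natCast]
    gcongr
    norm_num
  have hkp : 12 * (k : ℝ) ^ 2 + 10 ≤ 2 ^ k := by
    exact_mod_cast twelve_mul_sq_add_ten_le_two_pow hk11
  have hk11' : (11 : ℝ) ≤ k := by exact_mod_cast hk11
  have hdk : 2 * (k : ℝ) ^ 2 + 1 ≤ d := by linarith
  have hkd : k ≤ d := by
    have : (k : ℝ) ≤ d := by nlinarith
    exact_mod_cast this
  refine ⟨k, by nlinarith, ?_⟩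
  have h1 : (d : ℝ) ^ k ≤ k ^ k * d.choose k := by exact_mod_cast pow_le_pow_mul_choose hkd
  -- Since (d - 1)(d + 1) ≥ 2k²(d + 1); the k-th power then bounds the squared binomial below by
  -- (2(d + 1))^k.
  have h2 : (k : ℝ) ^ 2 * (2 * (d + 1)) ≤ d ^ 2 := by nlinarith
  have h3 : ((k : ℝ) ^ k) ^ 2 * (2 ^ k * (d + 1) ^ k) ≤ ((k : ℝ) ^ k) ^ 2 * (d.choose k : ℝ) ^ 2 := by
    calc ((k : ℝ) ^ k) ^ 2 * (2 ^ k * (d + 1) ^ k) = ((k : ℝ) ^ 2 * (2 * (d + 1))) ^ k := by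
          rw [mul_pow, mul_pow, ← pow_mul, ← pow_mul, mul_comm k 2]
      _ ≤ ((d : ℝ) ^ 2) ^ k := by gcongr
      _ = ((d : ℝ) ^ k) ^ 2 := by rw [← pow_mul, ← pow_mul, mul_comm]
      _ ≤ ((k : ℝ) ^ k * d.choose k) ^ 2 := by gcongr
      _ = _ := by rw [mul_pow]
  have h4 := le_of_mul_le_mul_left h3 (by positivity)
  refine le_trans ?_ h4
  have h5 : ((d : ℝ) + 1) ^ N ≤ ((d : ℝ) + 1) ^ k := by
    rw [← Real.rpow_natCast]
    exact Real.rpow_le_rpow_of_exponent_le (by linarith [(Nat.cast_nonneg d : (0 : ℝ) ≤ d)]) hkN.le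
  have h6 : (4 : ℝ) ≤ 2 ^ k := by nlinarith
  gcongr

/-! ### Popular shifts and the final count -/

theorem card_shiftInter_add_shiftDefect {n : ℕ} (A : Finset (Fin n → ZMod 2))
    (s : Fin n → ZMod 2) : (shiftInter A s).card + shiftDefect A s = A.card := by
  have : shiftInter A s = A.filter fun x => s + x ∈ A := by
    ext x
    simp only [shiftInter, Finset.mem_inter, Finset.mem_filter, Finset.singleton_add,
      Finset.mem_vadd_finset, vadd_eq_add]
    refine and_congr_right fun _ => ⟨?_, fun h => ⟨s + x, h, add_add_self_left s x⟩⟩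
    rintro ⟨y, hy, rfl⟩
    rwa [add_add_self_left]
  rw [this, shiftDefect, Finset.card_filter_add_card_filter_not]

theorem shiftDefect_lt_of_mem_popularPart {n : ℕ} {A : Finset (Fin n → ZMod 2)} {K ε : ℝ}
    {a b : Fin n → ZMod 2} (h : b ∈ popularPart A K ε a) :
    (shiftDefect A (a + b) : ℝ) < K ^ (-ε) * A.card := by
  have h1 := (Finset.mem_filter.1 h).2
  have h2 : ((shiftInter A (a + b)).card : ℝ) + shiftDefect A (a + b) = A.card := by
    exact_mod_cast card_shiftInter_add_shiftDefect A (a + b)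
  linarith

theorem add_one_le_four_rpow {K ε : ℝ} (hK : 1 < K) {L d : ℕ} (hε : 0 < ε)
    (h : ((d : ℝ) + 1) ^ (ε * Real.logb 2 K) ≤ (K ^ L) ^ 2) :
    (d : ℝ) + 1 ≤ 4 ^ ((L : ℝ) / ε) := by
  have hlog : 0 < Real.logb 2 K := Real.logb_pos (by norm_num) hK
  have hN : 0 < ε * Real.logb 2 K := by positivity
  rw [← Real.rpow_le_rpow_iff (by positivity) (by positivity) hN]
  refine h.trans (le_of_eq ?_)
  rw [← Real.rpow_mul (by norm_num), show (L : ℝ) / ε * (ε * Real.logb 2 K) = Real.logb 2 K * L by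
    field_simp, Real.rpow_mul (by norm_num), Real.rpow_natCast, ← pow_mul, mul_comm L 2, pow_mul]
  congr 1
  rw [show (4 : ℝ) = 2 ^ (2 : ℝ) by norm_num, ← Real.rpow_mul (by norm_num), mul_comm,
    Real.rpow_mul (by norm_num), Real.rpow_logb (by norm_num) (by norm_num) (by linarith)]
  norm_num

theorem theorem3 (n : ℕ) (A : Finset (Fin n → ZMod 2)) (hA : A.Nonempty)
    (K : ℝ) (hK : ((A + A).card : ℝ) = K * (A.card : ℝ))
    (a : Fin n → ZMod 2) (L : ℕ) (ε : ℝ) (hε : ε > 10 / Real.logb 2 K)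
    (hB : ((popularPart A K ε a).card : ℝ) ≥ K ^ (-(L : ℝ)) * (A.card : ℝ)) :
    (Nat.card (Submodule.span (ZMod 2) (popularPart A K ε a : Set (Fin n → ZMod 2))) : ℝ)
      ≤ (2 : ℝ) ^ ((4 : ℝ) ^ ((L : ℝ) / ε)) * ((A + A).card : ℝ) := by
  have hA' : (0 : ℝ) < A.card := by exact_mod_cast hA.card_pos
  have hK1 : 1 ≤ K := by
    have h : (A.card : ℝ) ≤ (A + A).card := by exact_mod_cast Finset.card_le_card_add_right hA
    rw [hK] at h
    exact le_of_mul_le_mul_right (by linarith) hA'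
  have hlog0 : 0 ≤ Real.logb 2 K := Real.logb_nonneg (by norm_num) hK1
  -- At K = 1 the logarithm vanishes and 10 / 0 = 0, so `hε` reads ε > 0.
  have hε0 : 0 < ε := lt_of_le_of_lt (by positivity) hε
  set B := popularPart A K ε a with hBdef
  set C := B.image fun b => a + b with hCdef
  have hCcard : C.card = B.card := Finset.card_image_of_injective _ (add_right_injective a)
  have hBne : B.Nonempty := by
    rw [← Finset.card_pos]
    have : (0 : ℝ) < B.card := lt_of_lt_of_le (by positivity) hB
    exact_mod_cast this
  have hCne : C.Nonempty := hBne.image _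
  have hdef : ∀ c ∈ C, (shiftDefect A c : ℝ) < K ^ (-ε) * A.card := by
    intro c hc
    obtain ⟨b, hb, rfl⟩ := Finset.mem_image.1 hc
    exact shiftDefect_lt_of_mem_popularPart hb
  have hspan : (Nat.card (Submodule.span (ZMod 2) (B : Set (Fin n → ZMod 2))) : ℝ) ≤
      2 * Nat.card (Submodule.span (ZMod 2) (C : Set (Fin n → ZMod 2))) := by
    exact_mod_cast card_span_le_two_mul_card (a := a) fun b hb =>
      Submodule.subset_span (Finset.mem_coe.2 (Finset.mem_image_of_mem _ hb))
  have hsmall : (∀ x ∈ Submodule.span (ZMod 2) (C : Set (Fin n → ZMod 2)), x ∈ A + A) →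
      (Nat.card (Submodule.span (ZMod 2) (B : Set (Fin n → ZMod 2))) : ℝ)
        ≤ (2 : ℝ) ^ ((4 : ℝ) ^ ((L : ℝ) / ε)) * ((A + A).card : ℝ) := by
    intro h
    have h1 : (Nat.card (Submodule.span (ZMod 2) (C : Set (Fin n → ZMod 2))) : ℝ)
        ≤ (A + A).card := by
      have := Set.ncard_le_ncard (s := (Submodule.span (ZMod 2) (C : Set (Fin n → ZMod 2)) : Set _))
        (t := ((A + A : Finset _) : Set (Fin n → ZMod 2)))
        (fun x hx => Finset.mem_coe.2 (h x hx)) (Finset.finite_toSet _)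
      rw [Set.ncard_coe_finset] at this
      exact_mod_cast this
    have h2 : (2 : ℝ) ≤ 2 ^ ((4 : ℝ) ^ ((L : ℝ) / ε)) := by
      refine Real.self_le_rpow_of_one_le (by norm_num) ?_
      exact Real.one_le_rpow (by norm_num) (by positivity)
    exact hspan.trans (by gcongr)
  -- For K = 1, δ = 1 and the dichotomy is unavailable, but A + A is already closed under addition.
  rcases hK1.eq_or_lt with rfl | hK1
  · refine hsmall (span_subset_of_card_add_eq hA ?_ fun c hc => ?_)
    · rw [one_mul] at hK
      exact_mod_cast hK
    · have := hdef c hc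
      rw [Real.one_rpow, one_mul] at this
      exact mem_add_of_shiftDefect_lt (by exact_mod_cast this)
  have hlog : 0 < Real.logb 2 K := Real.logb_pos (by norm_num) hK1
  have hN : 10 < ε * Real.logb 2 K := (div_lt_iff₀ hlog).1 hε
  have hKε : (2 : ℝ) ^ (ε * Real.logb 2 K) = K ^ ε := by
    rw [mul_comm, Real.rpow_mul (by norm_num),
      Real.rpow_logb (by norm_num) (by norm_num) (by linarith)]
  have hKε0 : 0 < K ^ ε := by positivity
  have hKε2 : 2 ≤ K ^ ε := by
    rw [← hKε]
    exact Real.self_le_rpow_of_one_le (by norm_num) (by linarith)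
  have hneg : K ^ (-ε) = (K ^ ε)⁻¹ := Real.rpow_neg (by linarith) ε
  rcases span_subset_or_card_span_le hA hCne (δ := K ^ (-ε)) (by positivity)
    (by rw [hneg, ← div_eq_mul_inv, div_le_one hKε0]; exact hKε2) hdef with h | ⟨d, hd, hcard, hch⟩
  · exact hsmall h
  rw [hneg, ← div_eq_mul_inv, one_lt_div hKε0, ← hKε] at hd
  obtain ⟨k, hk, hkd⟩ := exists_four_mul_rpow_le_choose_sq hN hd
  have h1 := hch k (by
    rw [hneg, ← mul_assoc, ← div_eq_mul_inv, div_le_one hKε0, ← hKε]; exact hk)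
  have h2 : (d.choose k : ℝ) ≤ 2 * K ^ L := by
    have h3 : (d.choose k : ℝ) * B.card ≤ 2 * A.card := by rw [← hCcard]; exact_mod_cast h1
    have h4 : (d.choose k : ℝ) * (K ^ (-(L : ℝ)) * A.card) ≤ 2 * A.card :=
      (mul_le_mul_of_nonneg_left hB (by positivity)).trans h3
    rw [← mul_assoc] at h4
    have h5 := le_of_mul_le_mul_right h4 hA'
    rwa [Real.rpow_neg (by linarith), Real.rpow_natCast, ← div_eq_mul_inv,
      div_le_iff₀ (by positivity)] at h5
  have h3 : (d : ℝ) + 1 ≤ 4 ^ ((L : ℝ) / ε) := by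
    refine add_one_le_four_rpow hK1 hε0 ?_
    have : (d.choose k : ℝ) ^ 2 ≤ (2 * K ^ L) ^ 2 := by gcongr
    rw [mul_pow] at this
    linarith
  calc (Nat.card (Submodule.span (ZMod 2) (B : Set (Fin n → ZMod 2))) : ℝ)
      ≤ 2 * (2 ^ d * (A + A).card) := hspan.trans (by gcongr; exact_mod_cast hcard)
    _ = 2 ^ ((d : ℝ) + 1) * (A + A).card := by
        rw [← mul_assoc, Real.rpow_add_one (by norm_num), Real.rpow_natCast, mul_comm (2 : ℝ)]
    _ ≤ _ := by gcongr; norm_num
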